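/- Let $Q_n$ be the $n$-cube with vertex set $V_n=\{0,1\}^n\subset\mathbb R^n$, and let $B_n$ be its group of symmetries: the maps $x\mapsto y$ of $\mathbb R^n$ with $y_i=x_{\pi(i)}$ or $y_i=1-x_{\pi(i)}$ for each $i$, where $\pi$ is a permutation of $\{1,\dots,n\}$ and the choice may depend on $i$. For $S\subseteq\mathbb R^n$ put $V_n(S)=V_n\cap S$ and $F(S)=\{w\in B_n: w(S)=S\}$. A $0/1$-polytope is the convex hull of a subset of $V_n$. Let $N_S(k)$ be the number of classes of $0/1$-polytopes with exactly $k$ vertices contained in $S$, where two such polytopes are equivalent if some element of $B_n$ maps one onto the other. For a subgroup $G\le F(S)$ acting on $V_n(S)$, let $$C_{G,S}(u_1,u_2)=\frac1{|G|}\sum_{g\in G}\prod_{i\ge1}(u_1^i+u_2^i)^{c_i(g)},$$ where $c_i(g)$ is the number of $i$-cycles of the permutation of $V_n(S)$ induced by $g$; this is the cycle index of $G$ on $V_n(S)$ with $u_1^i+u_2^i$ substituted for $z_i$. Write $[u_1^pu_2^q]C$ for the coefficient of $u_1^pu_2^q$ in $C$. **Theorem.** Let $2^{n-3}<k\le 2^{n-2}$,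 and let $H$ be a spanned hyperplane of $Q_n$ (a hyperplane of $\mathbb R^n$ spanned by $n$ affinely independent vertices of $Q_n$) with $|V_n(H)|\ge k$. Let $E(H,k)$ be the set of all intersections $H\cap w(H)$ with $w\in B_n$, $w(H)\ne H$ and $|V_n(H\cap w(H))|\ge k$. Let $E_1(H,k)$ be a set of representatives of the equivalence classes of $E(H,k)$ under the symmetries in $F(H)$, and let $E_2(H,k)$ be a set of representatives of the equivalence classes of $E(H,k)$ under the symmetries in $B_n$. For $w\in B_n$ put $q(w)=|V_n(H\cap w(H))|$ and $F(H,w)=\{w'\in F(H): w'(H\cap w(H))=H\cap w(H)\}$. Then $$\begin{aligned}N_H(k)={}&[u_1^ku_2^{|V_n(H)|-k}]\,C_{F(H),H}(u_1,u_2)\\&-\sum_{H\cap w(H)\in E_1(H,k)}[u_1^ku_2^{q(w)-k}]\,C_{F(H,w),\,H\cap w(H)}(u_1,u_2)\\&+\sum_{H\cap w(H)\in E_2(H,k)}[u_1^ku_2^{q(w)-k}]\,C_{F(H\cap w(H)),\,H\cap w(H)}(u_1,u_2).\end{aligned}$$ -/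

import Mathlib

open scoped Pointwise

/-- The vertex set `{0,1}^n` of the hypercube `Q_n`. -/
def cubeVertices (n : ℕ) : Set (Fin n → ℝ) :=
  {x | ∀ i, x i = 0 ∨ x i = 1}

/-- The set of vertices of `Q_n` lying in `S`. -/
def verticesIn {n : ℕ} (S : Set (Fin n → ℝ)) : Set (Fin n → ℝ) :=
  cubeVertices n ∩ S

/-- The group `B_n` of symmetries of `Q_n`: a signed permutation with underlying permutation `π`
and set of minus signs `{i | ε i = true}` acts on `ℝ^n` by sending `x` to `y`, where
`y i = 1 - x (π i)` if `i` carries a minus sign and `y i = x (π i)` otherwise. -/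
def cubeSymm (n : ℕ) : Subgroup (Equiv.Perm (Fin n → ℝ)) where
  carrier := {w | ∃ (π : Equiv.Perm (Fin n)) (ε : Fin n → Bool), ∀ x i,
    w x i = if ε i then 1 - x (π i) else x (π i)}
  one_mem' := ⟨1, fun _ => false, by simp⟩
  mul_mem' := by
    rintro w₁ w₂ ⟨π₁, ε₁, h₁⟩ ⟨π₂, ε₂, h₂⟩
    refine ⟨π₂ * π₁, fun i => xor (ε₁ i) (ε₂ (π₁ i)), fun x i => ?_⟩
    rw [Equiv.Perm.mul_apply, h₁, h₂]
    rcases h1 : ε₁ i <;> rcases h2 : ε₂ (π₁ i) <;> simp [h1, h2]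
  inv_mem' := by
    rintro w ⟨π, ε, h⟩
    refine ⟨π⁻¹, fun i => ε (π⁻¹ i), fun y i => ?_⟩
    obtain ⟨x, rfl⟩ := w.surjective y
    have hx : w⁻¹ (w x) = x := w.symm_apply_apply x
    have hi : π (π⁻¹ i) = i := π.apply_symm_apply i
    rw [hx, h, hi]
    split_ifs <;> simp

theorem smul_mem_cubeVertices {n : ℕ} (w : cubeSymm n) {x : Fin n → ℝ}
    (hx : x ∈ cubeVertices n) : w • x ∈ cubeVertices n := by
  obtain ⟨w, π, ε, h⟩ := w
  intro i
  change w x i = 0 ∨ w x i = 1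
  rw [h]
  cases ε i <;> rcases hx (π i) with h0 | h0 <;> simp [h0]

instance {n : ℕ} : Finite (cubeSymm n) := by
  have key : ∀ w : cubeSymm n, ∃ p : Equiv.Perm (Fin n) × (Fin n → Bool),
      ∀ x i, w.1 x i = if p.2 i then 1 - x (p.1 i) else x (p.1 i) := by
    rintro ⟨w, π, ε, h⟩
    exact ⟨(π, ε), h⟩
  choose f hf using key
  refine Finite.of_injective f fun w₁ w₂ h => ?_
  apply Subtype.ext
  ext x i
  rw [hf w₁, hf w₂, h]

instance {n : ℕ} (S : Set (Fin n → ℝ)) : Finite (verticesIn S) := by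
  refine Finite.of_injective
    (fun (x : verticesIn S) (i : Fin n) => (decide (x.1 i = 0) : Bool)) fun x y h => ?_
  apply Subtype.ext
  funext i
  have h' := congrFun h i
  simp only [decide_eq_decide] at h'
  rcases x.2.1 i with hx | hx <;> rcases y.2.1 i with hy | hy <;> simp_all

/-- A spanned hyperplane of `Q_n`: the affine span of `n` affinely independent vertices. -/
def IsSpannedHyperplane {n : ℕ} (H : Set (Fin n → ℝ)) : Prop :=
  ∃ v : Fin n → (Fin n → ℝ), (∀ i, v i ∈ cubeVertices n) ∧ AffineIndependent ℝ v ∧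
    H = (affineSpan ℝ (Set.range v) : Set (Fin n → ℝ))

/-- A `0/1`-polytope of `Q_n`: the convex hull of a set of vertices of `Q_n`. -/
def IsZeroOnePolytope {n : ℕ} (P : Set (Fin n → ℝ)) : Prop :=
  ∃ T ⊆ cubeVertices n, P = convexHull ℝ T

/-- The `0/1`-polytopes of `Q_n` contained in `S` and having exactly `k` vertices
(extreme points). -/
def PolytopesIn {n : ℕ} (S : Set (Fin n → ℝ)) (k : ℕ) : Type :=
  {P : Set (Fin n → ℝ) // IsZeroOnePolytope P ∧ P ⊆ S ∧ (P.extremePoints ℝ).ncard = k}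

/-- Two `0/1`-polytopes contained in `S` are equivalent if some symmetry of `Q_n` transforms one
into the other. -/
def partialEquivalence {n : ℕ} (S : Set (Fin n → ℝ)) (k : ℕ) : Setoid (PolytopesIn S k) :=
  (MulAction.orbitRel (cubeSymm n) (Set (Fin n → ℝ))).comap Subtype.val

/-- `N_S(k)`: the number of partial `0/1`-equivalence classes of `S` with `k` vertices. -/
noncomputable def numPartialClasses {n : ℕ} (S : Set (Fin n → ℝ)) (k : ℕ) : ℕ :=
  Nat.card (Quotient (partialEquivalence S k))

open Classical in
/-- The cycle index of a finite group `G` acting on a finite set `X`: the average over `g ∈ G` of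
`∏ z_i ^ c_i(g)`, where `c_i(g)` is the number of `i`-cycles (fixed points included, for `i = 1`)
of the permutation of `X` induced by `g`. -/
noncomputable def cycleIndex (G X : Type*) [Group G] [MulAction G X] [Finite G] [Finite X] :
    MvPolynomial ℕ ℚ :=
  letI := Fintype.ofFinite G
  letI := Fintype.ofFinite X
  MvPolynomial.C (1 / (Fintype.card G : ℚ)) *
    ∑ g : G, (((MulAction.toPerm g : Equiv.Perm X).partition.parts).map MvPolynomial.X).prod

/-- A subgroup of the stabilizer of `S` acts on the set of vertices of `Q_n` lying in `S`. -/
@[reducible] def verticesAction {n : ℕ} (S : Set (Fin n → ℝ)) (G : Subgroup (cubeSymm n))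
    (hG : G ≤ MulAction.stabilizer (cubeSymm n) S) : MulAction G (verticesIn S) where
  smul g x := ⟨(g : cubeSymm n) • (x : Fin n → ℝ), smul_mem_cubeVertices _ x.2.1, by
    have h := Set.smul_mem_smul_set (a := (g : cubeSymm n)) x.2.2
    rwa [MulAction.mem_stabilizer_iff.1 (hG g.2)] at h⟩
  one_smul _ := Subtype.ext (one_smul (cubeSymm n) _)
  mul_smul a b _ := Subtype.ext (mul_smul (a : cubeSymm n) (b : cubeSymm n) _)

/-- The polynomial in `u_1, u_2` (the variables `0` and `1`) obtained from the cycle index of `G`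
acting on the vertices of `Q_n` in `S` by substituting `u_1 ^ i + u_2 ^ i` for `z_i`. -/
noncomputable def polyaPolynomial {n : ℕ} (S : Set (Fin n → ℝ)) (G : Subgroup (cubeSymm n))
    (hG : G ≤ MulAction.stabilizer (cubeSymm n) S) : MvPolynomial (Fin 2) ℚ :=
  letI := verticesAction S G hG
  MvPolynomial.aeval (fun i : ℕ => (MvPolynomial.X 0 ^ i + MvPolynomial.X 1 ^ i :
    MvPolynomial (Fin 2) ℚ)) (cycleIndex G (verticesIn S))

/-- The coefficient of `u_1 ^ k * u_2 ^ (q - k)` in the above polynomial, where `q` is the number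
of vertices of `Q_n` in `S`. -/
noncomputable def polyaCoeff {n : ℕ} (S : Set (Fin n → ℝ)) (G : Subgroup (cubeSymm n))
    (hG : G ≤ MulAction.stabilizer (cubeSymm n) S) (k : ℕ) : ℚ :=
  (polyaPolynomial S G hG).coeff
    (Finsupp.single 0 k + Finsupp.single 1 ((verticesIn S).ncard - k))

/-- The intersection `H ∩ w(H)`. -/
def interSymm {n : ℕ} (H : Set (Fin n → ℝ)) (w : cubeSymm n) : Set (Fin n → ℝ) :=
  H ∩ (w • H)

/-- The set `E(H,k)` of the intersections `H ∩ w(H)`, `w ∈ B_n`, with `w(H) ≠ H`, that contain at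
least `k` vertices of `Q_n`. -/
def intersections {n : ℕ} (H : Set (Fin n → ℝ)) (k : ℕ) : Set (Set (Fin n → ℝ)) :=
  {S | ∃ w : cubeSymm n, H ≠ w • H ∧ k ≤ (verticesIn (interSymm H w)).ncard ∧
    S = interSymm H w}

/-- The intersections `H ∩ w(H)`, `w ∈ R`, form a complete set of representatives, without
repetition, of the equivalence classes of `E(H,k)` under the symmetries in `G`. -/
def IsRepresentatives {n : ℕ} (H : Set (Fin n → ℝ)) (k : ℕ) (G : Subgroup (cubeSymm n))
    (R : Finset (cubeSymm n)) : Prop :=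
  (∀ w ∈ R, interSymm H w ∈ intersections H k) ∧
    ∀ S ∈ intersections H k, ∃! w, w ∈ R ∧ ∃ g ∈ G, g • S = interSymm H w

/-- The stabilizer `F(H)` of a set `H` in `B_n`. -/
abbrev stab {n : ℕ} (H : Set (Fin n → ℝ)) : Subgroup (cubeSymm n) :=
  MulAction.stabilizer (cubeSymm n) H

/-- The group `F(H,w)` of the elements of `F(H)` that stabilize `H ∩ w(H)`. -/
abbrev stabInter {n : ℕ} (H : Set (Fin n → ℝ)) (w : cubeSymm n) : Subgroup (cubeSymm n) :=
  stab H ⊓ stab (interSymm H w)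

/-!
A `0/1`-polytope is determined by its vertices, so `N_H(k)` counts the `k`-sets of vertices lying
in `H` up to `B_n`, while by Pólya's theorem each coefficient counts the `k`-sets of vertices lying
in some set up to a group stabilizing that set. If `w` carries one `k`-set of vertices in `H` to
another one, `A`, then either `w` stabilizes `H` or `A` lies in `H ∩ w(H)`. In the latter case `A`
spans `H ∩ w(H)`: this flat has dimension at most `n - 2`, and a flat of smaller dimension contains
at most `2 ^ (n - 3) < k` points of the cube. Hence `B_n`-equivalence and `F(H)`-equivalence can
differ only on the `k`-sets whose affine span belongs to `E(H,k)`. Both numbers of classes of such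
sets are computed by sorting the sets by their affine spans, which gives the two sums over
representatives.
-/

section CycleIndex

open Equiv.Perm Finset

/-- A label for the cycle of `σ` through `x`: the corresponding cycle factor of `σ`, or `x` itself
if `σ` fixes `x`. The labels index the parts of `σ.partition`. -/
def cycleLabel {X : Type*} [Fintype X] [DecidableEq X] (σ : Equiv.Perm X) (x : X) :
    Equiv.Perm X ⊕ X :=
  if σ x = x then .inr x else .inl (σ.cycleOf x)

section Label

variable {X : Type*} [Fintype X] [DecidableEq X] (σ : Equiv.Perm X)

theorem cycleLabel_eq_iff {x y : X} : cycleLabel σ x = cycleLabel σ y ↔ σ.SameCycle x y := by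
  by_cases hx : σ x = x
  · have hxy : σ.SameCycle x y ↔ x = y :=
      ⟨fun h => h.eq_of_left hx, fun h => h ▸ SameCycle.refl σ x⟩
    grind [cycleLabel]
  · by_cases hy : σ y = y
    · have hxy : ¬ σ.SameCycle x y := fun h => hx (h.apply_eq_self_iff.2 hy)
      grind [cycleLabel]
    · simp [cycleLabel, hx, hy, sameCycle_iff_cycleOf_eq_of_mem_support]

theorem image_cycleLabel :
    univ.image (cycleLabel σ) = σ.cycleFactorsFinset.disjSum σ.supportᶜ := by
  ext (c | x)
  · simp only [mem_image, mem_univ, true_and, inl_mem_disjSum]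
    constructor
    · rintro ⟨x, hx⟩
      grind [cycleLabel, cycleOf_mem_cycleFactorsFinset_iff, mem_support]
    · intro hc
      obtain ⟨x, hx⟩ := (mem_cycleFactorsFinset_iff.1 hc).1.nonempty_support
      have hσx := mem_support.1 (mem_cycleFactorsFinset_support_le hc hx)
      exact ⟨x, by rw [cycleLabel, if_neg hσx, cycle_is_cycleOf hx hc]⟩
  · simp only [mem_image, mem_univ, true_and, inr_mem_disjSum, mem_compl, mem_support, not_not]
    exact ⟨fun h => by grind [cycleLabel], fun hx => ⟨x, if_pos hx⟩⟩

theorem filter_cycleLabel_eq_inl {c : Equiv.Perm X} (hc : c ∈ σ.cycleFactorsFinset) :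
    ({x | cycleLabel σ x = .inl c} : Finset X) = c.support := by
  ext x
  rw [mem_filter_univ]
  constructor
  · intro h
    have hx : σ x ≠ x := by grind [cycleLabel]
    obtain rfl : σ.cycleOf x = c := by grind [cycleLabel]
    exact mem_support_cycleOf_iff.2 ⟨.refl σ x, mem_support.2 hx⟩
  · intro hx
    have hσx := mem_support.1 (mem_cycleFactorsFinset_support_le hc hx)
    rw [cycleLabel, if_neg hσx, cycle_is_cycleOf hx hc]

theorem filter_cycleLabel_eq_inr {y : X} (hy : σ y = y) :
    ({x | cycleLabel σ x = .inr y} : Finset X) = {y} := by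
  grind [cycleLabel]

theorem prod_map_parts_partition {M : Type*} [CommMonoid M] (f : ℕ → M) :
    (σ.partition.parts.map f).prod =
      ∏ l ∈ univ.image (cycleLabel σ), f #{x | cycleLabel σ x = l} := by
  rw [image_cycleLabel, prod_disjSum, parts_partition, Multiset.map_add, Multiset.prod_add]
  congr 1
  · rw [cycleType_def, Multiset.map_map]
    exact prod_congr rfl fun c hc => by rw [filter_cycleLabel_eq_inl σ hc, Function.comp_apply,
      Function.comp_apply]
  · rw [Multiset.map_replicate, Multiset.prod_replicate, ← card_compl, ← prod_const]
    refine prod_congr rfl fun y hy => ?_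
    rw [filter_cycleLabel_eq_inr σ (by simpa using hy), card_singleton]

end Label

theorem prod_pow_card_fiber_add {X Q R : Type*} [Fintype X] [DecidableEq Q] [CommSemiring R]
    (f : X → Q) {L : Finset Q} (hL : ∀ x, f x ∈ L) (a b : R) :
    ∏ l ∈ L, (a ^ #{x | f x = l} + b ^ #{x | f x = l}) =
      ∑ t ∈ L.powerset, a ^ #{x | f x ∈ t} * b ^ #{x | f x ∉ t} := by
  rw [prod_add]
  refine sum_congr rfl fun t _ => ?_
  rw [prod_pow_eq_pow_sum, prod_pow_eq_pow_sum, sum_card_fiberwise_eq_card_filter,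
    sum_card_fiberwise_eq_card_filter]
  simp only [mem_sdiff, hL, true_and]

theorem mem_iff_of_sameCycle_of_smul_eq {X : Type*} [DecidableEq X] {σ : Equiv.Perm X}
    {s : Finset X} (hs : σ • s = s) {x y : X} (h : σ.SameCycle x y) : x ∈ s ↔ y ∈ s := by
  obtain ⟨i, rfl⟩ := h
  have hi : σ ^ i • s = s := (MulAction.stabilizer (Equiv.Perm X) s).zpow_mem hs i
  conv_rhs => rw [← hi]
  exact (smul_mem_smul_finset_iff (σ ^ i)).symm

/-- The sets invariant under `σ` are the unions of cycles of `σ`, and each cycle can be taken or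
left independently of the others. -/
theorem prod_map_parts_partition_pow_add_pow {X R : Type*} [Fintype X] [DecidableEq X]
    [CommSemiring R] (σ : Equiv.Perm X) (a b : R) :
    (σ.partition.parts.map fun i => a ^ i + b ^ i).prod =
      ∑ s : Finset X with σ • s = s, a ^ #s * b ^ #sᶜ := by
  rw [prod_map_parts_partition, prod_pow_card_fiber_add _ fun x => mem_image_of_mem _ (mem_univ x)]
  refine sum_bij' (fun t _ => ({x | cycleLabel σ x ∈ t} : Finset X))
    (fun s _ => s.image (cycleLabel σ)) ?_ ?_ ?_ ?_ ?_
  · intro t _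
    have hσ : ∀ x, cycleLabel σ (σ.symm x) = cycleLabel σ x := fun x =>
      (cycleLabel_eq_iff σ).2 ⟨1, by simp⟩
    refine (mem_filter_univ _).2 ?_
    ext x
    simp [← inv_smul_mem_iff, Equiv.Perm.smul_def, hσ]
  · intro s _
    exact mem_powerset.2 (image_subset_image (subset_univ s))
  · intro t ht
    have := mem_powerset.1 ht
    grind
  · intro s hs
    ext x
    simp only [mem_filter_univ, mem_image]
    refine ⟨fun ⟨y, hy, hyx⟩ => ?_, fun hx => ⟨x, hx, rfl⟩⟩
    exact (mem_iff_of_sameCycle_of_smul_eq (by simpa using hs)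
      ((cycleLabel_eq_iff σ).1 hyx)).1 hy
  · intro t _
    rw [← compl_filter]

theorem coeff_prod_map_parts_partition {X : Type*} [Fintype X] [DecidableEq X]
    (σ : Equiv.Perm X) (k : ℕ) :
    ((σ.partition.parts.map fun i =>
      (MvPolynomial.X 0 ^ i + MvPolynomial.X 1 ^ i : MvPolynomial (Fin 2) ℚ)).prod).coeff
      (Finsupp.single 0 k + Finsupp.single 1 (Fintype.card X - k)) =
      #{s : Finset X | σ • s = s ∧ #s = k} := by
  have hterm : ∀ s : Finset X, MvPolynomial.coeff
      (Finsupp.single 0 k + Finsupp.single 1 (Fintype.card X - k))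
      (MvPolynomial.X 0 ^ #s * MvPolynomial.X 1 ^ #sᶜ : MvPolynomial (Fin 2) ℚ) =
        if #s = k then 1 else 0 := by
    intro s
    rw [MvPolynomial.X_pow_eq_monomial, MvPolynomial.X_pow_eq_monomial, MvPolynomial.monomial_mul,
      MvPolynomial.coeff_monomial, one_mul]
    refine if_congr ⟨fun h => ?_, fun h => ?_⟩ rfl rfl
    · simpa using DFunLike.congr_fun h 0
    · rw [card_compl, h]
  rw [prod_map_parts_partition_pow_add_pow, MvPolynomial.coeff_sum,
    sum_congr rfl fun s _ => hterm s, sum_boole, filter_filter]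

theorem card_fixedBy_powersetCard {G X : Type*} [Group G] [MulAction G X] [Fintype X]
    [DecidableEq X] (g : G) (k : ℕ) :
    Nat.card (MulAction.fixedBy (Set.powersetCard X k) g) =
      #{s : Finset X | (MulAction.toPerm g : Equiv.Perm X) • s = s ∧ #s = k} := by
  rw [Nat.card_coe_set_eq, ← Set.ncard_image_of_injective _ Subtype.val_injective,
    ← Set.ncard_coe_finset]
  congr 1
  ext s
  simp only [Set.mem_image, MulAction.mem_fixedBy, coe_filter, mem_univ, true_and,
    Set.mem_ofPred_eq]
  constructor
  · rintro ⟨s, hs, rfl⟩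
    exact ⟨congrArg Subtype.val hs, s.2⟩
  · rintro ⟨hs, hk⟩
    exact ⟨⟨s, hk⟩, Subtype.ext hs, rfl⟩

/-- Pólya's enumeration theorem for two colours, a colouring being recorded by its set of points of
the first colour. -/
theorem coeff_aeval_cycleIndex {G X : Type*} [Group G] [MulAction G X] [Finite G] [Finite X]
    [DecidableEq X] (k : ℕ) :
    (MvPolynomial.aeval (fun i : ℕ => (MvPolynomial.X 0 ^ i + MvPolynomial.X 1 ^ i :
      MvPolynomial (Fin 2) ℚ)) (cycleIndex G X)).coeff
      (Finsupp.single 0 k + Finsupp.single 1 (Nat.card X - k)) =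
      Nat.card (Quotient (MulAction.orbitRel G (Set.powersetCard X k))) := by
  classical
  let _ := Fintype.ofFinite G
  let _ := Fintype.ofFinite X
  have burnside : ∑ g : G, (Nat.card (MulAction.fixedBy (Set.powersetCard X k) g) : ℚ) =
      Nat.card (Quotient (MulAction.orbitRel G (Set.powersetCard X k))) * Fintype.card G := by
    simp only [Nat.card_eq_fintype_card]
    exact_mod_cast MulAction.sum_card_fixedBy_eq_card_orbits_mul_card_group G
      (Set.powersetCard X k)
  have hG : (Fintype.card G : ℚ) ≠ 0 := Nat.cast_ne_zero.2 Fintype.card_ne_zero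
  simp only [cycleIndex, map_mul, map_sum, map_multiset_prod, Multiset.map_map,
    Function.comp_def, MvPolynomial.aeval_X, MvPolynomial.aeval_C, MvPolynomial.algebraMap_eq,
    MvPolynomial.coeff_C_mul, MvPolynomial.coeff_sum]
  rw [Nat.card_eq_fintype_card (α := X), one_div, inv_mul_eq_iff_eq_mul₀ hG, mul_comm, ← burnside]
  refine sum_congr rfl fun g _ => ?_
  rw [card_fixedBy_powersetCard, ← coeff_prod_map_parts_partition]
  congr!

end CycleIndex

section NumOrbits

variable {Γ α : Type*} [Group Γ] [MulAction Γ α]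

/-- The number of orbits of the subgroup `G` that meet `Y`. The set `Y` need not be invariant
under `G`, so that one set can be counted up to the action of several groups. -/
noncomputable def numOrbits (G : Subgroup Γ) (Y : Set α) : ℕ :=
  (MulAction.orbit G '' Y).ncard

theorem orbit_subgroup_eq_iff {G : Subgroup Γ} {x y : α} :
    MulAction.orbit G x = MulAction.orbit G y ↔ ∃ g ∈ G, g • y = x := by
  simp only [MulAction.orbit_eq_iff, MulAction.mem_orbit_iff, Subtype.exists, Subgroup.mk_smul,
    exists_prop]

theorem card_quotient_eq_numOrbits {γ : Type*} {G : Subgroup Γ} {r : Setoid γ} {f : γ → α}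
    (h : ∀ a b, r a b ↔ ∃ g ∈ G, g • f b = f a) :
    Nat.card (Quotient r) = numOrbits G (Set.range f) := by
  obtain rfl : r = Setoid.ker (MulAction.orbit G ∘ f) :=
    Setoid.ext fun a b => (h a b).trans orbit_subgroup_eq_iff.symm
  rw [Nat.card_congr (Setoid.quotientKerEquivRange _), Nat.card_coe_set_eq, Set.range_comp,
    numOrbits]

theorem numOrbits_eq_of_le {G K : Subgroup Γ} {Y : Set α} (hKG : K ≤ G)
    (h : ∀ g ∈ G, ∀ y ∈ Y, g • y ∈ Y → g ∈ K) : numOrbits K Y = numOrbits G Y := by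
  let r : Setoid Y := Setoid.ker (MulAction.orbit G ∘ Subtype.val)
  have hG : ∀ a b, r a b ↔ ∃ g ∈ G, g • (b : α) = a := fun _ _ => orbit_subgroup_eq_iff
  have hK : ∀ a b, r a b ↔ ∃ g ∈ K, g • (b : α) = a := fun a b => (hG a b).trans
    ⟨fun ⟨g, hg, hab⟩ => ⟨g, h g hg b b.2 (hab ▸ a.2), hab⟩, fun ⟨g, hg, hab⟩ => ⟨g, hKG hg, hab⟩⟩
  simpa only [Subtype.range_coe] using
    (card_quotient_eq_numOrbits hK).symm.trans (card_quotient_eq_numOrbits hG)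

theorem numOrbits_eq_of_subset {G : Subgroup Γ} {Y Z : Set α} (hZY : Z ⊆ Y)
    (h : ∀ y ∈ Y, ∃ g ∈ G, g • y ∈ Z) : numOrbits G Z = numOrbits G Y := by
  refine congrArg Set.ncard ((Set.image_mono hZY).antisymm ?_)
  rintro _ ⟨y, hy, rfl⟩
  obtain ⟨g, hg, hgy⟩ := h y hy
  exact ⟨g • y, hgy, orbit_subgroup_eq_iff.2 ⟨g, hg, rfl⟩⟩

theorem numOrbits_union {G : Subgroup Γ} {Y Z : Set α} (hY : Y.Finite) (hZ : Z.Finite)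
    (h : ∀ g ∈ G, ∀ y ∈ Y, g • y ∉ Z) :
    numOrbits G (Y ∪ Z) = numOrbits G Y + numOrbits G Z := by
  rw [numOrbits, Set.image_union, Set.ncard_union_eq _ (hY.image _) (hZ.image _), numOrbits,
    numOrbits]
  rw [Set.disjoint_left]
  rintro _ ⟨y, hy, rfl⟩ ⟨z, hz, hzy⟩
  obtain ⟨g, hg, rfl⟩ := orbit_subgroup_eq_iff.1 hzy
  exact h g hg y hy hz

theorem numOrbits_biUnion {ι : Type*} {G : Subgroup Γ} {R : Finset ι} {Y : ι → Set α}
    (hY : ∀ i ∈ R, (Y i).Finite)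
    (h : ∀ i ∈ R, ∀ j ∈ R, ∀ g ∈ G, ∀ y ∈ Y i, g • y ∈ Y j → i = j) :
    numOrbits G (⋃ i ∈ R, Y i) = ∑ i ∈ R, numOrbits G (Y i) := by
  classical
  induction R using Finset.induction_on with
  | empty => simp [numOrbits]
  | insert a R ha ih =>
    simp only [Finset.forall_mem_insert] at hY h
    rw [Finset.set_biUnion_insert, Finset.sum_insert ha, numOrbits_union hY.1, ih hY.2]
    · exact fun i hi => (h.2 i hi).2
    · exact R.finite_toSet.biUnion hY.2
    · intro g hg y hy hgy
      obtain ⟨i, hi, hgy⟩ := Set.mem_iUnion₂.1 hgy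
      exact ha (h.1.2 i hi g hg y hy hgy ▸ hi)

/-- Each orbit on the part of `W` over `E` meets exactly one of the fibres over the
representatives `S i`, and it meets it in one orbit of the stabilizer of `S i` in `G`. -/
theorem numOrbits_eq_sum_fibers {β ι : Type*} [MulAction Γ β] {G : Subgroup Γ} {W : Set α}
    (hW : W.Finite) (hGW : ∀ g ∈ G, ∀ x ∈ W, g • x ∈ W) {f : α → β}
    (hf : ∀ g ∈ G, ∀ x ∈ W, f (g • x) = g • f x) {E : Set β} {R : Finset ι} {S : ι → β}
    (hSE : ∀ i ∈ R, S i ∈ E) (hR : ∀ b ∈ E, ∃! i, i ∈ R ∧ ∃ g ∈ G, g • b = S i) :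
    numOrbits G {x ∈ W | f x ∈ E} =
      ∑ i ∈ R, numOrbits (G ⊓ MulAction.stabilizer Γ (S i)) {x ∈ W | f x = S i} := by
  have hmeet : numOrbits G (⋃ i ∈ R, {x ∈ W | f x = S i}) = numOrbits G {x ∈ W | f x ∈ E} := by
    refine numOrbits_eq_of_subset
      (Set.iUnion₂_subset fun i hi x hx => ⟨hx.1, hx.2 ▸ hSE i hi⟩) fun x ⟨hxW, hxE⟩ => ?_
    obtain ⟨i, ⟨hi, g, hg, hgS⟩, -⟩ := hR _ hxE
    exact ⟨g, hg, Set.mem_iUnion₂.2 ⟨i, hi, hGW g hg x hxW, by rw [hf g hg x hxW, hgS]⟩⟩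
  have hmove : ∀ {i j}, ∀ g ∈ G, ∀ x ∈ {x ∈ W | f x = S i}, g • x ∈ {x ∈ W | f x = S j} →
      g • S i = S j := fun g hg x hx hgx => by rw [← hx.2, ← hf g hg x hx.1, hgx.2]
  rw [← hmeet, numOrbits_biUnion (fun i _ => hW.subset fun x hx => hx.1)]
  · exact Finset.sum_congr rfl fun i _ => (numOrbits_eq_of_le inf_le_left
      fun g hg x hx hgx => Subgroup.mem_inf.2 ⟨hg, hmove g hg x hx hgx⟩).symm
  · intro i hi j hj g hg x hx hgx
    exact (hR (S i) (hSE i hi)).unique ⟨hi, 1, G.one_mem, one_smul _ _⟩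
      ⟨hj, g, hg, hmove g hg x hx hgx⟩

theorem numOrbits_add_numOrbits {G K : Subgroup Γ} {Y Z : Set α} (hY : Y.Finite) (hKG : K ≤ G)
    (hZY : Z ⊆ Y) (hK : ∀ g ∈ K, ∀ z ∈ Z, g • z ∈ Y → g • z ∈ Z)
    (hG : ∀ g ∈ G, g ∉ K → ∀ y ∈ Y, g • y ∈ Y → g • y ∈ Z) :
    numOrbits G Y + numOrbits K Z = numOrbits K Y + numOrbits G Z := by
  have hGZ : ∀ g ∈ G, ∀ z ∈ Z, g • z ∉ Y \ Z := fun g hg z hz hgz =>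
    hgz.2 <| (em (g ∈ K)).elim (fun h => hK g h z hz hgz.1) fun h => hG g hg h z (hZY hz) hgz.1
  have hsplit : ∀ L ≤ G, numOrbits L Y = numOrbits L Z + numOrbits L (Y \ Z) := fun L hL => by
    rw [← numOrbits_union (hY.subset hZY) (hY.subset Set.sdiff_subset)
      fun g hg => hGZ g (hL hg), Set.union_sdiff_cancel hZY]
  have houtside : numOrbits K (Y \ Z) = numOrbits G (Y \ Z) :=
    numOrbits_eq_of_le hKG fun g hg y hy hgy =>
      by_contra fun h => hgy.2 (hG g hg h y hy.1 hgy.1)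
  rw [hsplit G le_rfl, hsplit K hKG, houtside]
  ring

end NumOrbits

section Coordinates

variable {K ι : Type*} [Field K] [Finite ι]

theorem exists_finset_card_eq_finrank_forall_eq_zero (V : Submodule K (ι → K)) :
    ∃ J : Finset ι, J.card = Module.finrank K V ∧ ∀ v ∈ V, (∀ j ∈ J, v j = 0) → v = 0 := by
  classical
  let coord : ι → Module.Dual K V := fun i => LinearMap.proj i ∘ₗ V.subtype
  obtain ⟨κ, a, ha, hspan, hli⟩ := exists_linearIndependent' K coord
  have := Finite.of_injective a ha
  have := Fintype.ofFinite κ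
  have hcoord : ∀ v : V, (∀ j, v.1 (a j) = 0) → v = 0 := fun v hv => by
    have hle : Submodule.span K (Set.range coord) ≤ LinearMap.ker (Module.Dual.eval K V v) := by
      rw [← hspan, Submodule.span_le]
      rintro _ ⟨j, rfl⟩
      exact hv j
    exact Subtype.ext (funext fun i => hle (Submodule.subset_span ⟨i, rfl⟩))
  have hrank : Fintype.card κ = Module.finrank K V := by
    refine le_antisymm (Subspace.dual_finrank_eq (K := K) (V := V) ▸
      hli.fintype_card_le_finrank) ?_
    rw [← Module.finrank_fintype_fun_eq_card K]
    refine LinearMap.finrank_le_finrank_of_injective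
      (f := LinearMap.pi fun j => coord (a j)) ((injective_iff_map_eq_zero _).2 fun v hv => ?_)
    exact hcoord v fun j => congrFun hv j
  refine ⟨Finset.univ.map ⟨a, ha⟩, by rw [Finset.card_map, Finset.card_univ, hrank],
    fun v hv h => ?_⟩
  exact congrArg Subtype.val (hcoord ⟨v, hv⟩ fun j => h _ (by simp))

theorem ncard_le_card_pow_finrank {A : Set (ι → K)} {T : Finset K} (hA : ∀ x ∈ A, ∀ i, x i ∈ T) :
    A.ncard ≤ T.card ^ Module.finrank K (vectorSpan K A) := by
  classical
  obtain ⟨J, hJ, hzero⟩ := exists_finset_card_eq_finrank_forall_eq_zero (vectorSpan K A)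
  have hinj : Set.InjOn (fun (x : ι → K) (j : J) => x j) A := fun x hx y hy hxy =>
    sub_eq_zero.1 <| hzero (x - y) (vsub_mem_vectorSpan K hx hy) fun j hj =>
      sub_eq_zero.2 (congrFun hxy ⟨j, hj⟩)
  calc A.ncard ≤ (Fintype.piFinset fun _ : J => T : Set (J → K)).ncard :=
        Set.ncard_le_ncard_of_injOn _ (fun x hx => Finset.mem_coe.2 <|
          Fintype.mem_piFinset.2 fun j => hA x hx j) hinj (Finset.finite_toSet _)
    _ = T.card ^ Module.finrank K (vectorSpan K A) := by
        rw [Set.ncard_coe_finset, Fintype.card_piFinset, Finset.prod_const, Finset.card_univ,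
          Fintype.card_coe, hJ]

end Coordinates

theorem finrank_direction_inf_lt {k V P : Type*} [DivisionRing k] [AddCommGroup V] [Module k V]
    [AddTorsor V P] {Q Q' : AffineSubspace k P} [FiniteDimensional k Q.direction]
    [FiniteDimensional k Q'.direction] (hne : Q ≠ Q')
    (hle : Module.finrank k Q'.direction ≤ Module.finrank k Q.direction)
    (hQ : (Q ⊓ Q' : Set P).Nonempty) :
    Module.finrank k (Q ⊓ Q').direction < Module.finrank k Q.direction := by
  refine Submodule.finrank_lt_finrank_of_lt
    (AffineSubspace.direction_lt_of_nonempty (inf_le_left.lt_of_ne fun h => ?_) hQ)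
  rw [inf_eq_left] at h
  exact hne <| AffineSubspace.eq_of_direction_eq_of_nonempty_of_le
    (Submodule.eq_of_le_of_finrank_le (AffineSubspace.direction_le h) hle)
    (hQ.mono Set.inter_subset_left) h

section Cube

variable {n : ℕ}

theorem finite_cubeVertices : (cubeVertices n).Finite := by
  rw [← Set.inter_univ (cubeVertices n)]
  exact Set.toFinite (verticesIn Set.univ)

theorem ncard_le_two_pow_finrank {A : Set (Fin n → ℝ)} (hA : A ⊆ cubeVertices n) :
    A.ncard ≤ 2 ^ Module.finrank ℝ (vectorSpan ℝ A) := by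
  have h01 : ∀ x ∈ A, ∀ i, x i ∈ ({0, 1} : Finset ℝ) := fun x hx i => by simpa using hA hx i
  simpa using ncard_le_card_pow_finrank h01

theorem affineSpan_eq_of_two_pow_finrank_lt {A : Set (Fin n → ℝ)} (hA : A ⊆ cubeVertices n)
    {P : AffineSubspace ℝ (Fin n → ℝ)} (hAP : A ⊆ P)
    (h : 2 ^ Module.finrank ℝ P.direction < 2 * A.ncard) : affineSpan ℝ A = P := by
  have hne : A.Nonempty := Set.nonempty_of_ncard_ne_zero fun h0 => by simp [h0] at h
  have hle : affineSpan ℝ A ≤ P := affineSpan_le.2 hAP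
  have hlt : 2 ^ Module.finrank ℝ P.direction < 2 ^ (Module.finrank ℝ (vectorSpan ℝ A) + 1) := by
    rw [pow_succ']
    exact h.trans_le (Nat.mul_le_mul_left 2 (ncard_le_two_pow_finrank hA))
  refine AffineSubspace.eq_of_direction_eq_of_nonempty_of_le
    (Submodule.eq_of_le_of_finrank_le (AffineSubspace.direction_le hle) ?_)
    ((affineSpan_nonempty ℝ).2 hne) hle
  rw [direction_affineSpan]
  exact Nat.lt_succ_iff.1 ((Nat.pow_lt_pow_iff_right one_lt_two).1 hlt)

theorem extremePoints_convexHull_of_subset_cubeVertices {T : Set (Fin n → ℝ)}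
    (hT : T ⊆ cubeVertices n) : (convexHull ℝ T).extremePoints ℝ = T := by
  have hcube : (Set.univ.pi fun _ : Fin n => Set.Icc (0 : ℝ) 1).extremePoints ℝ =
      cubeVertices n := by
    rw [extremePoints_pi]
    ext y
    simp [cubeVertices, Set.mem_pi]
  have hsub : convexHull ℝ T ⊆ Set.univ.pi fun _ => Set.Icc 0 1 :=
    convexHull_min (hT.trans (hcube ▸ extremePoints_subset))
      (convex_pi fun _ _ => convex_Icc _ _)
  exact extremePoints_convexHull_subset.antisymm fun x hx =>
    inter_extremePoints_subset_extremePoints_of_subset hsub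
      ⟨subset_convexHull ℝ T hx, hcube ▸ hT hx⟩

end Cube

section Symmetries

variable {n : ℕ}

theorem smul_subset_cubeVertices (w : cubeSymm n) {A : Set (Fin n → ℝ)}
    (hA : A ⊆ cubeVertices n) : w • A ⊆ cubeVertices n :=
  Set.smul_set_subset_iff.2 fun _ hx => smul_mem_cubeVertices w (hA hx)

theorem exists_affineMap_coe_eq_smul (w : cubeSymm n) :
    ∃ f : (Fin n → ℝ) →ᵃ[ℝ] (Fin n → ℝ), ⇑f = (w • ·) := by
  obtain ⟨w, π, ε, h⟩ := w
  let coord (i : Fin n) : (Fin n → ℝ) →ᵃ[ℝ] ℝ := AffineMap.proj i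
  refine ⟨AffineMap.pi fun i => if ε i then AffineMap.const ℝ _ 1 - coord (π i) else coord (π i),
    funext fun x => funext fun i => ?_⟩
  change _ = w x i
  rw [h]
  cases hi : ε i <;> simp [hi, coord]

theorem smul_convexHull (w : cubeSymm n) (T : Set (Fin n → ℝ)) :
    w • convexHull ℝ T = convexHull ℝ (w • T) := by
  obtain ⟨f, hf⟩ := exists_affineMap_coe_eq_smul w
  rw [← Set.image_smul, ← Set.image_smul, ← hf, f.image_convexHull]

theorem coe_affineSpan_smul (w : cubeSymm n) (T : Set (Fin n → ℝ)) :
    (affineSpan ℝ (w • T) : Set (Fin n → ℝ)) = w • (affineSpan ℝ T : Set (Fin n → ℝ)) := by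
  obtain ⟨f, hf⟩ := exists_affineMap_coe_eq_smul w
  rw [← Set.image_smul, ← Set.image_smul, ← hf, ← AffineSubspace.map_span, AffineSubspace.coe_map]

theorem exists_affineSubspace_coe_eq_smul (w : cubeSymm n) (Q : AffineSubspace ℝ (Fin n → ℝ)) :
    ∃ Q' : AffineSubspace ℝ (Fin n → ℝ), (Q' : Set (Fin n → ℝ)) = w • (Q : Set (Fin n → ℝ)) ∧
      Module.finrank ℝ Q'.direction ≤ Module.finrank ℝ Q.direction := by
  obtain ⟨f, hf⟩ := exists_affineMap_coe_eq_smul w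
  refine ⟨Q.map f, by rw [AffineSubspace.coe_map, hf, Set.image_smul], ?_⟩
  rw [AffineSubspace.map_direction]
  exact Submodule.finrank_map_le _ _

theorem coe_affineSpan_eq_interSymm {Q : AffineSubspace ℝ (Fin n → ℝ)} {w : cubeSymm n}
    (hw : (Q : Set (Fin n → ℝ)) ≠ w • (Q : Set (Fin n → ℝ))) {A : Set (Fin n → ℝ)}
    (hA : A ⊆ cubeVertices n) (hAw : A ⊆ interSymm Q w)
    (h : 2 ^ Module.finrank ℝ Q.direction < 4 * A.ncard) :
    (affineSpan ℝ A : Set (Fin n → ℝ)) = interSymm Q w := by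
  obtain ⟨Q', hQ', hrank⟩ := exists_affineSubspace_coe_eq_smul w Q
  rw [interSymm, ← hQ'] at hAw ⊢
  have hne : Q ≠ Q' := fun hQ => hw (hQ' ▸ congrArg _ hQ)
  have hlt := finrank_direction_inf_lt hne hrank
    ((Set.nonempty_of_ncard_ne_zero fun h0 => by simp [h0] at h).mono hAw)
  have hpow : 2 * 2 ^ Module.finrank ℝ (Q ⊓ Q').direction ≤ 2 ^ Module.finrank ℝ Q.direction := by
    rw [← pow_succ']
    exact Nat.pow_le_pow_right two_pos hlt
  rw [affineSpan_eq_of_two_pow_finrank_lt hA (P := Q ⊓ Q') hAw (by omega)]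
  rfl

end Symmetries

section VertexSets

variable {n k : ℕ}

/-- The sets of `k` vertices of `Q_n` lying in `S`. For convex `S` they are the vertex sets of the
`0/1`-polytopes contained in `S` with exactly `k` vertices. -/
def vertexSets (S : Set (Fin n → ℝ)) (k : ℕ) : Set (Set (Fin n → ℝ)) :=
  {A | A ⊆ verticesIn S ∧ A.ncard = k}

theorem finite_vertexSets (S : Set (Fin n → ℝ)) (k : ℕ) : (vertexSets S k).Finite :=
  finite_cubeVertices.finite_subsets.subset fun _ hA => hA.1.trans Set.inter_subset_left

theorem smul_mem_vertexSets_univ (g : cubeSymm n) {A : Set (Fin n → ℝ)}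
    (hA : A ∈ vertexSets Set.univ k) : g • A ∈ vertexSets Set.univ k :=
  ⟨Set.subset_inter (smul_subset_cubeVertices g (hA.1.trans Set.inter_subset_left))
    (Set.subset_univ _), by rw [Set.ncard_smul_set, hA.2]⟩

theorem smul_convexHull_eq_iff (g : cubeSymm n) {T U : Set (Fin n → ℝ)} (hT : T ⊆ cubeVertices n)
    (hU : U ⊆ cubeVertices n) : g • convexHull ℝ T = convexHull ℝ U ↔ g • T = U := by
  rw [smul_convexHull]
  refine ⟨fun h => ?_, fun h => by rw [h]⟩
  rw [← extremePoints_convexHull_of_subset_cubeVertices (smul_subset_cubeVertices g hT), h,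
    extremePoints_convexHull_of_subset_cubeVertices hU]

theorem numPartialClasses_eq_numOrbits {S : Set (Fin n → ℝ)} (hS : Convex ℝ S) :
    numPartialClasses S k = numOrbits (⊤ : Subgroup (cubeSymm n)) (vertexSets S k) := by
  have hrange : Set.range (fun P : PolytopesIn S k => P.1.extremePoints ℝ) = vertexSets S k := by
    ext A
    constructor
    · rintro ⟨⟨_, ⟨T, hT, rfl⟩, hS, hk⟩, rfl⟩
      exact ⟨Set.subset_inter (extremePoints_convexHull_subset.trans hT)
        (extremePoints_subset.trans hS), hk⟩
    · rintro ⟨hA, hk⟩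
      have hext := extremePoints_convexHull_of_subset_cubeVertices
        (hA.trans Set.inter_subset_left)
      exact ⟨⟨convexHull ℝ A, ⟨A, hA.trans Set.inter_subset_left, rfl⟩,
        convexHull_min (hA.trans Set.inter_subset_right) hS, by rw [hext, hk]⟩, hext⟩
  rw [numPartialClasses, ← hrange]
  refine card_quotient_eq_numOrbits ?_
  rintro ⟨_, ⟨T, hT, rfl⟩, _⟩ ⟨_, ⟨U, hU, rfl⟩, _⟩
  change convexHull ℝ T ∈ MulAction.orbit (cubeSymm n) (convexHull ℝ U) ↔ _
  simp only [MulAction.mem_orbit_iff, Subgroup.mem_top, true_and, smul_convexHull_eq_iff _ hU hT,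
    extremePoints_convexHull_of_subset_cubeVertices hT,
    extremePoints_convexHull_of_subset_cubeVertices hU]

theorem range_image_val_powersetCard (S : Set (Fin n → ℝ)) (k : ℕ) :
    Set.range (fun s : Set.powersetCard (verticesIn S) k =>
      (Subtype.val '' (s.1 : Set (verticesIn S)) : Set (Fin n → ℝ))) = vertexSets S k := by
  ext A
  constructor
  · rintro ⟨s, rfl⟩
    refine ⟨Subtype.coe_image_subset _ _, ?_⟩
    rw [Set.ncard_image_of_injective _ Subtype.val_injective, Set.ncard_coe_finset]
    exact s.2
  · rintro ⟨hA, hk⟩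
    obtain ⟨s, rfl⟩ := Set.subset_range_iff_exists_image_eq.1
      (hA.trans Subtype.range_coe.superset)
    lift s to Finset (verticesIn S) using Set.toFinite s
    rw [Set.ncard_image_of_injective _ Subtype.val_injective, Set.ncard_coe_finset] at hk
    exact ⟨⟨s, hk⟩, rfl⟩

theorem polyaCoeff_eq_numOrbits (S : Set (Fin n → ℝ)) (G : Subgroup (cubeSymm n))
    (hG : G ≤ MulAction.stabilizer (cubeSymm n) S) (k : ℕ) :
    polyaCoeff S G hG k = numOrbits G (vertexSets S k) := by
  classical
  let _ := verticesAction S G hG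
  rw [polyaCoeff, polyaPolynomial, ← Nat.card_coe_set_eq, coeff_aeval_cycleIndex,
    ← range_image_val_powersetCard]
  refine congrArg Nat.cast (card_quotient_eq_numOrbits fun s t => ?_)
  have hsmul : ∀ g : G, (Subtype.val '' ((g • t).1 : Set (verticesIn S)) : Set (Fin n → ℝ)) =
      (g : cubeSymm n) • (Subtype.val '' (t.1 : Set (verticesIn S)) : Set (Fin n → ℝ)) :=
    fun g => by
      rw [Set.powersetCard.coe_smul, Finset.coe_smul_finset]
      exact Set.image_smul_comm Subtype.val g _ fun _ => rfl
  rw [MulAction.orbitRel_apply, MulAction.mem_orbit_iff, Subtype.exists]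
  refine exists_congr fun g => ⟨fun ⟨hg, h⟩ => ⟨hg, ?_⟩, fun ⟨hg, h⟩ => ⟨hg, ?_⟩⟩
  · rw [← hsmul ⟨g, hg⟩, h]
  · rw [← hsmul ⟨g, hg⟩] at h
    exact Subtype.ext (Finset.coe_injective (Subtype.val_injective.image_injective h))

end VertexSets

section Intersections

variable {n k : ℕ}

/-- The sets of `k` vertices of `Q_n` whose affine span is one of the intersections `H ∩ w(H)` of
`E(H,k)`. -/
def intersectionVertexSets (H : Set (Fin n → ℝ)) (k : ℕ) : Set (Set (Fin n → ℝ)) :=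
  {A ∈ vertexSets Set.univ k | (affineSpan ℝ A : Set (Fin n → ℝ)) ∈ intersections H k}

theorem intersectionVertexSets_subset (H : Set (Fin n → ℝ)) (k : ℕ) :
    intersectionVertexSets H k ⊆ vertexSets H k := by
  rintro A ⟨hA, w, -, -, h⟩
  refine ⟨Set.subset_inter (hA.1.trans Set.inter_subset_left) ?_, hA.2⟩
  exact (subset_affineSpan ℝ A).trans (h.le.trans Set.inter_subset_left)

variable {Q : AffineSubspace ℝ (Fin n → ℝ)}

theorem mem_intersectionVertexSets (hk : 2 ^ Module.finrank ℝ Q.direction < 4 * k)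
    {A : Set (Fin n → ℝ)} (hA : A ∈ vertexSets Q k) {w : cubeSymm n}
    (hw : (Q : Set (Fin n → ℝ)) ≠ w • (Q : Set (Fin n → ℝ)))
    (hAw : A ⊆ w • (Q : Set (Fin n → ℝ))) : A ∈ intersectionVertexSets Q k := by
  obtain ⟨hA, rfl⟩ := hA
  have hcube : A ⊆ cubeVertices n := hA.trans Set.inter_subset_left
  have hAQ : A ⊆ interSymm Q w := Set.subset_inter (hA.trans Set.inter_subset_right) hAw
  refine ⟨⟨Set.subset_inter hcube (Set.subset_univ A), rfl⟩, w, hw, ?_,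
    coe_affineSpan_eq_interSymm hw hcube hAQ hk⟩
  exact Set.ncard_le_ncard (Set.subset_inter hcube hAQ) (Set.toFinite _)

theorem smul_mem_intersectionVertexSets (hk : 2 ^ Module.finrank ℝ Q.direction < 4 * k)
    {g : cubeSymm n} (hg : g ∈ stab (Q : Set (Fin n → ℝ)))
    {A : Set (Fin n → ℝ)} (hA : A ∈ intersectionVertexSets Q k) (hgA : g • A ∈ vertexSets Q k) :
    g • A ∈ intersectionVertexSets Q k := by
  obtain ⟨-, w, hw, -, h⟩ := hA
  refine mem_intersectionVertexSets hk hgA (w := g * w) ?_ ?_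
  · rw [mul_smul]
    intro hgw
    exact hw (MulAction.injective g ((MulAction.mem_stabilizer_iff.1 hg).trans hgw))
  · rw [mul_smul]
    exact Set.smul_set_mono ((subset_affineSpan ℝ A).trans (h.le.trans Set.inter_subset_right))

theorem setOf_coe_affineSpan_eq (hk : 2 ^ Module.finrank ℝ Q.direction < 4 * k)
    {S : Set (Fin n → ℝ)} (hS : S ∈ intersections Q k) :
    {A ∈ vertexSets Set.univ k | (affineSpan ℝ A : Set (Fin n → ℝ)) = S} = vertexSets S k := by
  obtain ⟨w, hw, -, rfl⟩ := hS
  ext A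
  constructor
  · rintro ⟨hA, h⟩
    exact ⟨Set.subset_inter (hA.1.trans Set.inter_subset_left) (h ▸ subset_affineSpan ℝ A), hA.2⟩
  · rintro ⟨hA, rfl⟩
    have hcube : A ⊆ cubeVertices n := hA.trans Set.inter_subset_left
    exact ⟨⟨Set.subset_inter hcube (Set.subset_univ A), rfl⟩,
      coe_affineSpan_eq_interSymm hw hcube (hA.trans Set.inter_subset_right) hk⟩

theorem numOrbits_intersectionVertexSets (hk : 2 ^ Module.finrank ℝ Q.direction < 4 * k)
    {G : Subgroup (cubeSymm n)} {R : Finset (cubeSymm n)} (hR : IsRepresentatives Q k G R) :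
    numOrbits G (intersectionVertexSets (Q : Set (Fin n → ℝ)) k) =
      ∑ w ∈ R, numOrbits (G ⊓ stab (interSymm Q w)) (vertexSets (interSymm Q w) k) :=
  (numOrbits_eq_sum_fibers (finite_vertexSets _ k) (fun g _ _ => smul_mem_vertexSets_univ g)
    (fun g _ A _ => coe_affineSpan_smul g A) hR.1 hR.2).trans <|
    Finset.sum_congr rfl fun w hw => by rw [setOf_coe_affineSpan_eq hk (hR.1 w hw)]

end Intersections

theorem IsSpannedHyperplane.exists_affineSubspace {n : ℕ} {H : Set (Fin n → ℝ)}
    (hH : IsSpannedHyperplane H) : ∃ Q : AffineSubspace ℝ (Fin n → ℝ),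
      (Q : Set (Fin n → ℝ)) = H ∧ Module.finrank ℝ Q.direction = n - 1 := by
  obtain ⟨v, -, hv, rfl⟩ := hH
  refine ⟨_, rfl, ?_⟩
  rw [direction_affineSpan]
  rcases n with - | n
  · exact Module.finrank_zero_of_subsingleton
  · exact hv.finrank_vectorSpan (Fintype.card_fin _)

theorem two_pow_sub_one_lt_four_mul {n k : ℕ} (hk : (2 : ℝ) ^ ((n : ℤ) - 3) < k) :
    2 ^ (n - 1) < 4 * k := by
  rcases n with - | n
  · have hpos : 0 < k := Nat.cast_pos.1 ((zpow_pos two_pos _).trans hk)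
    omega
  · have h : (2 : ℝ) ^ n = 4 * 2 ^ (((n + 1 : ℕ) : ℤ) - 3) := by
      rw [← zpow_natCast, show (4 : ℝ) = 2 ^ (2 : ℤ) by norm_num, ← zpow_add₀ two_ne_zero]
      congr 1
      push_cast
      ring
    have hlt : (2 : ℝ) ^ n < 4 * k := by linarith
    exact_mod_cast hlt

theorem theorem8p4_general {n k : ℕ} {Q : AffineSubspace ℝ (Fin n → ℝ)}
    (hk : 2 ^ Module.finrank ℝ Q.direction < 4 * k) {R₁ R₂ : Finset (cubeSymm n)}
    (hR₁ : IsRepresentatives Q k (stab Q) R₁) (hR₂ : IsRepresentatives Q k ⊤ R₂) :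
    (numPartialClasses (Q : Set (Fin n → ℝ)) k : ℚ) =
      polyaCoeff (Q : Set (Fin n → ℝ)) (stab Q) le_rfl k
        - ∑ w ∈ R₁, polyaCoeff (interSymm Q w) (stabInter Q w) inf_le_right k
        + ∑ w ∈ R₂, polyaCoeff (interSymm Q w) (stab (interSymm Q w)) le_rfl k := by
  have horbits := numOrbits_add_numOrbits (finite_vertexSets (Q : Set (Fin n → ℝ)) k)
    (le_top : stab (Q : Set (Fin n → ℝ)) ≤ ⊤) (intersectionVertexSets_subset _ k)
    (fun g hg A => smul_mem_intersectionVertexSets hk hg)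
    (fun g _ hg A hA hgA => mem_intersectionVertexSets hk hgA (Ne.symm hg)
      (Set.smul_set_mono (hA.1.trans Set.inter_subset_right)))
  rw [numOrbits_intersectionVertexSets hk hR₁, numOrbits_intersectionVertexSets hk hR₂,
    ← numPartialClasses_eq_numOrbits Q.convex] at horbits
  simp only [top_inf_eq] at horbits
  simp only [polyaCoeff_eq_numOrbits]
  rw [sub_add_eq_add_sub, eq_sub_iff_add_eq]
  exact_mod_cast horbits

theorem theorem8p4 (n k : ℕ) (hk₁ : (2 : ℝ) ^ ((n : ℤ) - 3) < k)
    (hk₂ : (k : ℝ) ≤ (2 : ℝ) ^ ((n : ℤ) - 2))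
    (H : Set (Fin n → ℝ)) (hH : IsSpannedHyperplane H) (hkH : k ≤ (verticesIn H).ncard)
    (R₁ R₂ : Finset (cubeSymm n))
    (hR₁ : IsRepresentatives H k (stab H) R₁)
    (hR₂ : IsRepresentatives H k ⊤ R₂) :
    (numPartialClasses H k : ℚ) =
      polyaCoeff H (stab H) le_rfl k
        - ∑ w ∈ R₁, polyaCoeff (interSymm H w) (stabInter H w) inf_le_right k
        + ∑ w ∈ R₂, polyaCoeff (interSymm H w) (stab (interSymm H w)) le_rfl k := by
  obtain ⟨Q, rfl, hQ⟩ := hH.exists_affineSubspace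
  exact theorem8p4_general (hQ ▸ two_pow_sub_one_lt_four_mul hk₁) hR₁ hR₂
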